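/- Conventions. Let $G$ be a finite group and $\mathcal D(G)$ the category of finite left $G$-sets and $G$-maps; $\bullet$ is the one-point $G$-set. A *Mackey functor* $\mathcal M=(\mathcal M_*,\mathcal M^*)$ on $\mathcal D(G)$ consists of a covariant and a contravariant functor to abelian groups with the same value $\mathcal M(S)$ on each object $S$ (write $\varphi_{\mathcal M}$, $\varphi^{\mathcal M}$ for the maps induced by a $G$-map $\varphi$), such that $\varphi^{\mathcal M}\psi_{\mathcal M}=\Psi_{\mathcal M}\Phi^{\mathcal M}$ for every pullback square $\varphi\Psi=\psi\Phi$, such that $\mathcal M^*(S_1\sqcup S_2)\to\mathcal M^*(S_1)\oplus\mathcal M^*(S_2)$ is an isomorphism, and such that $\mathcal M(\emptyset)=0$. A *pairing* $\mathcal M\times\mathcal N\to\mathcal L$ is a family of bilinear maps $\mathcal M(S)\times\mathcal N(S)\to\mathcal L(S)$ with $\varphi^{\mathcal L}(x\cdot y)=\varphi^{\mathcal M}(x)\cdot\varphi^{\mathcal N}(y)$, $x\cdot\varphi_{\mathcal N}(y)=\varphi_{\mathcal L}(\varphi^{\mathcal M}(x)\cdot y)$ and $\varphi_{\mathcal M}(x)\cdot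 y=\varphi_{\mathcal L}(x\cdot\varphi^{\mathcal N}(y))$ for every $G$-map $\varphi$. A *Green ring* $\mathcal G$ is a Mackey functor with a pairing $\mathcal G\times\mathcal G\to\mathcal G$ making each $\mathcal G(S)$ an associative ring with unit $1_S$, with $\varphi^{\mathcal G}(1_T)=1_S$ for every $\varphi\colon S\to T$. It *acts on* a Mackey functor $\mathcal M$ if a pairing $\mathcal G\times\mathcal M\to\mathcal M$ is given that makes each $\mathcal M(S)$ a left unital $\mathcal G(S)$-module. For a prime $p$, $\mathcal M\otimes\mathbf Z_{(p)}$ is the Mackey functor $S\mapsto\mathcal M(S)\otimes\mathbf Z_{(p)}$. For $H\le G$ the maps $\mathrm{Ind}_H^G$ and $\mathrm{Res}_G^H$ are the covariant and contravariant maps induced by $G/H\to\bullet$, and $\mathcal M(G)$ means $\mathcal M(\bullet)$. For finite $G$-sets $X,Y$ put $Am_0(X,Y)=Y$ and $Am_r(X,Y)=X\times Am_{r-1}(X,Y)$, with face maps $d_i^r\colon Am_r(X,Y)\to Am_{r-1}(X,Y)$ for $0\le i<r$, where $d_0^r$ is the projection away from the first factor $X$ and $d_i^r=1_X\times d_{i-1}^{r-1}$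 for $i>0$. A Mackey functor $\mathcal M$ is *$X$-computable* if for every finite $G$-set $Y$ both complexes of abelian groups with groups $\mathcal M(Am_r(X,Y))$, $r\ge 0$, and differentials $\partial_r=\sum_i(-1)^i(d_i^r)_{\mathcal M}$, respectively $\delta^r=\sum_i(-1)^i(d_i^r)^{\mathcal M}$, are contractible. A *family* $\mathcal F$ of subgroups of $G$ is a set of subgroups closed under conjugation and passage to subgroups; $X(\mathcal F)$ is the disjoint union of the $G/H$ with one $H$ for each conjugacy class of maximal elements of $\mathcal F$, and *$\mathcal F$-computable* means $X(\mathcal F)$-computable. Let $O^p(H)$ be the intersection of all normal subgroups of $H$ whose quotient is a $p$-group; $\mathcal F$ is *$hyper_p$-closed* if the subgroups $H\le G$ with $O^p(H)\in\mathcal F$ are exactly the members of $\mathcal F$. **Theorem.** Let $G$ be a finite group, $p$ a prime, $\mathcal G$ a Green ring acting on a Mackey functor $\mathcal M$, and $\mathcal F$ a $hyper_p$-closed family of subgroups of $G$. If $\mathcal G\otimes\mathbf Z_{(p)}$ is $\mathcal F$-computable, then there are coefficients $a_H\in\mathbf Z_{(p)}$, $H\in\mathcal F$, such that for every $x\in\mathcal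 M(G)\otimes\mathbf Z_{(p)}$ $$x=\sum_{H\in\mathcal F}a_H\,\mathrm{Ind}_H^G\bigl(\mathrm{Res}_G^H(x)\bigr).$$ -/

import Mathlib

open scoped TensorProduct Pointwise

universe u v w

/-! ### Finite G-sets -/

/-- A finite left `G`-set. The objects of the category `𝒟(G)`; its morphisms are the equivariant
maps `S →[G] T`. -/
structure FinGSet (G : Type u) [Group G] where
  carrier : Type u
  [finite : Finite carrier]
  [action : MulAction G carrier]

namespace FinGSet

variable {G : Type u} [Group G]

instance : CoeSort (FinGSet G) (Type u) := ⟨FinGSet.carrier⟩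

attribute [instance] FinGSet.finite FinGSet.action

/-- The one-point `G`-set `• = G/G`. -/
abbrev point (G : Type u) [Group G] : FinGSet G := ⟨PUnit.{u + 1}⟩

/-- The transitive `G`-set `G/H`. -/
abbrev quot [Finite G] (H : Subgroup G) : FinGSet G := ⟨G ⧸ H⟩

/-- The disjoint union `S ⊔ T`. -/
abbrev sum (S T : FinGSet G) : FinGSet G := ⟨S ⊕ T⟩

/-- The product `S × T` with the diagonal action. -/
abbrev prod (S T : FinGSet G) : FinGSet G := ⟨S × T⟩

/-- The unique `G`-map `S → •`. -/
def toPoint (S : FinGSet G) : S →[G] point G where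
  toFun _ := PUnit.unit
  map_smul' _ _ := rfl

def inl (S T : FinGSet G) : S →[G] S.sum T where
  toFun := Sum.inl
  map_smul' _ _ := rfl

def inr (S T : FinGSet G) : T →[G] S.sum T where
  toFun := Sum.inr
  map_smul' _ _ := rfl

/-- The second projection `S × T → T`. -/
def snd (S T : FinGSet G) : S.prod T →[G] T where
  toFun x := x.2
  map_smul' _ _ := rfl

/-- The map `1_X × f : X × S → X × T`. -/
def idProd (X : FinGSet G) {S T : FinGSet G} (f : S →[G] T) : X.prod S →[G] X.prod T where
  toFun x := (x.1, f x.2)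
  map_smul' g x := Prod.ext rfl (map_smul f g x.2)

/-- The square `φ ∘ Ψ = ψ ∘ Φ` of finite `G`-sets commutes and is a pullback square. -/
def IsPullbackSquare {S S₁ S₂ T : FinGSet G} (Ψ : S →[G] S₁) (Φ : S →[G] S₂)
    (φ : S₁ →[G] T) (ψ : S₂ →[G] T) : Prop :=
  (∀ s, φ (Ψ s) = ψ (Φ s)) ∧
    ∀ (s₁ : S₁) (s₂ : S₂), φ s₁ = ψ s₂ → ∃! s : S, Ψ s = s₁ ∧ Φ s = s₂

end FinGSet

/-! ### Mackey functors, Green rings and Green modules -/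

/-- A Mackey functor: a bifunctor `(M_*, M^*)` from finite `G`-sets to abelian groups satisfying
the double coset formula (`pull_push`) and additivity (`additive`, `empty`). -/
structure MackeyFunctor (G : Type u) [Group G] where
  obj : FinGSet G → Type v
  [addCommGroup : ∀ S, AddCommGroup (obj S)]
  /-- the covariant maps `φ_M` -/
  push : ∀ {S T : FinGSet G}, (S →[G] T) → obj S →+ obj T
  /-- the contravariant maps `φ^M` -/
  pull : ∀ {S T : FinGSet G}, (S →[G] T) → obj T →+ obj S
  push_id : ∀ (S : FinGSet G) (x : obj S), push (MulActionHom.id G : S →[G] S) x = x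
  push_comp : ∀ {S T U : FinGSet G} (φ : S →[G] T) (ψ : T →[G] U) (x : obj S),
    push (ψ.comp φ) x = push ψ (push φ x)
  pull_id : ∀ (S : FinGSet G) (x : obj S), pull (MulActionHom.id G : S →[G] S) x = x
  pull_comp : ∀ {S T U : FinGSet G} (φ : S →[G] T) (ψ : T →[G] U) (x : obj U),
    pull (ψ.comp φ) x = pull φ (pull ψ x)
  pull_push : ∀ {S S₁ S₂ T : FinGSet G} (Ψ : S →[G] S₁) (Φ : S →[G] S₂)
    (φ : S₁ →[G] T) (ψ : S₂ →[G] T), FinGSet.IsPullbackSquare Ψ Φ φ ψ →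
    ∀ x : obj S₂, pull φ (push ψ x) = push Ψ (pull Φ x)
  additive : ∀ S T : FinGSet G, Function.Bijective
    ((pull (FinGSet.inl S T)).prod (pull (FinGSet.inr S T)))
  empty : ∀ S : FinGSet G, IsEmpty S → Subsingleton (obj S)

attribute [instance] MackeyFunctor.addCommGroup

/-- A pairing `M × N → L` of Mackey functors: biadditive maps `M(S) × N(S) → L(S)` compatible with
restriction and satisfying the two Frobenius formulas. -/
structure MackeyPairing {G : Type u} [Group G]
    (M : MackeyFunctor.{u, v} G) (N L : MackeyFunctor.{u, w} G) where
  mul : ∀ S : FinGSet G, M.obj S →+ N.obj S →+ L.obj S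
  pull_mul : ∀ {S T : FinGSet G} (φ : S →[G] T) (x : M.obj T) (y : N.obj T),
    L.pull φ (mul T x y) = mul S (M.pull φ x) (N.pull φ y)
  mul_push : ∀ {S T : FinGSet G} (φ : S →[G] T) (x : M.obj T) (y : N.obj S),
    mul T x (N.push φ y) = L.push φ (mul S (M.pull φ x) y)
  push_mul : ∀ {S T : FinGSet G} (φ : S →[G] T) (x : M.obj S) (y : N.obj T),
    mul T (M.push φ x) y = L.push φ (mul S x (N.pull φ y))

/-- A Green ring: a Mackey functor whose values are associative unital rings, with multiplication
a pairing, and with restriction maps preserving the units. -/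
structure GreenRing (G : Type u) [Group G] where
  functor : MackeyFunctor.{u, v} G
  pairing : MackeyPairing functor functor functor
  one : ∀ S : FinGSet G, functor.obj S
  mul_assoc : ∀ (S : FinGSet G) (a b c : functor.obj S),
    pairing.mul S (pairing.mul S a b) c = pairing.mul S a (pairing.mul S b c)
  one_mul : ∀ (S : FinGSet G) (a : functor.obj S), pairing.mul S (one S) a = a
  mul_one : ∀ (S : FinGSet G) (a : functor.obj S), pairing.mul S a (one S) = a
  pull_one : ∀ {S T : FinGSet G} (φ : S →[G] T), functor.pull φ (one T) = one S

/-- An action of a Green ring on a Mackey functor `M`, making `M` a (left, unital) Green module. -/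
structure GreenModule {G : Type u} [Group G]
    (𝒢 : GreenRing.{u, v} G) (M : MackeyFunctor.{u, w} G) where
  pairing : MackeyPairing 𝒢.functor M M
  mul_smul : ∀ (S : FinGSet G) (a b : 𝒢.functor.obj S) (x : M.obj S),
    pairing.mul S (𝒢.pairing.mul S a b) x = pairing.mul S a (pairing.mul S b x)
  one_smul : ∀ (S : FinGSet G) (x : M.obj S), pairing.mul S (𝒢.one S) x = x

/-! ### Extension of scalars -/

/-- The ideal `(p)` of `ℤ` is prime. -/
instance ZAtPrime.isPrime (p : ℕ) [hp : Fact p.Prime] : (Ideal.span {(p : ℤ)}).IsPrime :=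
  (Ideal.span_singleton_prime (by exact_mod_cast hp.out.ne_zero)).2
    (Nat.prime_iff_prime_int.1 hp.out)

/-- The localization `ℤ_(p)` of `ℤ` at the prime ideal `(p)`. -/
abbrev ZAtPrime (p : ℕ) [Fact p.Prime] : Type := Localization.AtPrime (Ideal.span {(p : ℤ)})

namespace MackeyFunctor

variable {G : Type u} [Group G]

/-- The Mackey functor `M ⊗ R`, with value `R ⊗_ℤ M(S)` on `S`. -/
def extend (M : MackeyFunctor.{u, v} G) (R : Type) [CommRing R] : MackeyFunctor.{u, v} G where
  obj S := R ⊗[ℤ] M.obj S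
  addCommGroup _ := inferInstance
  push φ := (LinearMap.lTensor R (M.push φ).toIntLinearMap).toAddMonoidHom
  pull φ := (LinearMap.lTensor R (M.pull φ).toIntLinearMap).toAddMonoidHom
  push_id S x := by
    induction x with
    | zero => simp
    | add x y hx hy => rw [map_add, hx, hy]
    | tmul r x => simp [M.push_id]
  push_comp φ ψ x := by
    induction x with
    | zero => simp
    | add x y hx hy => simp only [map_add, hx, hy]
    | tmul r x => simp [M.push_comp]
  pull_id S x := by
    induction x with
    | zero => simp
    | add x y hx hy => rw [map_add, hx, hy]
    | tmul r x => simp [M.pull_id]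
  pull_comp φ ψ x := by
    induction x with
    | zero => simp
    | add x y hx hy => simp only [map_add, hx, hy]
    | tmul r x => simp [M.pull_comp]
  pull_push Ψ Φ φ ψ h x := by
    induction x with
    | zero => simp
    | add x y hx hy => simp only [map_add, hx, hy]
    | tmul r x => simp [M.pull_push Ψ Φ φ ψ h]
  additive S T := by
    let e : M.obj (S.sum T) ≃ₗ[ℤ] (M.obj S × M.obj T) :=
      LinearEquiv.ofBijective
        ((M.pull (FinGSet.inl S T)).prod (M.pull (FinGSet.inr S T))).toIntLinearMap
        (M.additive S T)
    let e' := (LinearEquiv.lTensor R e).trans (TensorProduct.prodRight ℤ ℤ R (M.obj S) (M.obj T))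
    convert e'.bijective using 1
    funext x
    induction x with
    | zero => simp
    | add x y hx hy => rw [map_add, map_add, hx, hy]
    | tmul r x => rfl
  empty S hS := by
    have := M.empty S hS
    refine ⟨fun x y => ?_⟩
    have h0 : ∀ z : R ⊗[ℤ] M.obj S, z = 0 := fun z => by
      induction z with
      | zero => rfl
      | add x y hx hy => rw [hx, hy, add_zero]
      | tmul r x => rw [Subsingleton.elim x 0, TensorProduct.tmul_zero]
    rw [h0 x, h0 y]

/-- `M(S) ⊗ R` is an `R`-module, by multiplication on the factor `R`. -/
instance (M : MackeyFunctor.{u, v} G) (R : Type) [CommRing R] (S : FinGSet G) :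
    Module R ((M.extend R).obj S) :=
  inferInstanceAs (Module R (R ⊗[ℤ] M.obj S))

/-- Induction `Ind_H^G : M(G/H) → M(•)`. -/
def ind [Finite G] (M : MackeyFunctor.{u, v} G) (H : Subgroup G) :
    M.obj (FinGSet.quot H) →+ M.obj (FinGSet.point G) :=
  M.push (FinGSet.toPoint (FinGSet.quot H))

/-- Restriction `Res_G^H : M(•) → M(G/H)`. -/
def res [Finite G] (M : MackeyFunctor.{u, v} G) (H : Subgroup G) :
    M.obj (FinGSet.point G) →+ M.obj (FinGSet.quot H) :=
  M.pull (FinGSet.toPoint (FinGSet.quot H))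

end MackeyFunctor

/-! ### Amitsur complexes and computability -/

/-- `Am_0(X, Y) = Y` and `Am_{r+1}(X, Y) = X × Am_r(X, Y)`. -/
def amitsur {G : Type u} [Group G] (X Y : FinGSet G) : ℕ → FinGSet G
  | 0 => Y
  | r + 1 => X.prod (amitsur X Y r)

/-- The face maps `d_i : Am_{r+1}(X, Y) → Am_r(X, Y)`, `0 ≤ i ≤ r`: `d_0` is the projection off
the first factor and `d_{i+1} = 1_X × d_i`. -/
def amitsurFace {G : Type u} [Group G] (X Y : FinGSet G) :
    (r : ℕ) → Fin (r + 1) → (amitsur X Y (r + 1) →[G] amitsur X Y r)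
  | 0 => fun _ => FinGSet.snd X Y
  | r + 1 => Fin.cases (FinGSet.snd X (amitsur X Y (r + 1)))
      (fun i => FinGSet.idProd X (amitsurFace X Y r i))

namespace MackeyFunctor

variable {G : Type u} [Group G]

/-- The boundary operator `∂ = ∑ (-1)^i (d_i)_M : M(Am_{r+1}(X, Y)) → M(Am_r(X, Y))`. -/
def amitsurBoundary (M : MackeyFunctor.{u, v} G) (X Y : FinGSet G) (r : ℕ) :
    M.obj (amitsur X Y (r + 1)) →+ M.obj (amitsur X Y r) :=
  ∑ i : Fin (r + 1), (-1 : ℤ) ^ (i : ℕ) • M.push (amitsurFace X Y r i)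

/-- The coboundary operator `δ = ∑ (-1)^i (d_i)^M : M(Am_r(X, Y)) → M(Am_{r+1}(X, Y))`. -/
def amitsurCoboundary (M : MackeyFunctor.{u, v} G) (X Y : FinGSet G) (r : ℕ) :
    M.obj (amitsur X Y r) →+ M.obj (amitsur X Y (r + 1)) :=
  ∑ i : Fin (r + 1), (-1 : ℤ) ^ (i : ℕ) • M.pull (amitsurFace X Y r i)

/-- The covariant Amitsur complex
`⋯ → M(Am_2(X, Y)) → M(Am_1(X, Y)) → M(Am_0(X, Y)) → 0` is contractible:
there is a contracting homotopy, `∂ s + s ∂ = 1`. -/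
def AmitsurContractible (M : MackeyFunctor.{u, v} G) (X Y : FinGSet G) : Prop :=
  ∃ s : ∀ r : ℕ, M.obj (amitsur X Y r) →+ M.obj (amitsur X Y (r + 1)),
    (∀ x, M.amitsurBoundary X Y 0 (s 0 x) = x) ∧
    ∀ (r : ℕ) (x), M.amitsurBoundary X Y (r + 1) (s (r + 1) x) +
      s r (M.amitsurBoundary X Y r x) = x

/-- The contravariant Amitsur complex
`0 → M(Am_0(X, Y)) → M(Am_1(X, Y)) → M(Am_2(X, Y)) → ⋯` is contractible:
there is a contracting homotopy, `s δ + δ s = 1`. -/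
def CoAmitsurContractible (M : MackeyFunctor.{u, v} G) (X Y : FinGSet G) : Prop :=
  ∃ s : ∀ r : ℕ, M.obj (amitsur X Y (r + 1)) →+ M.obj (amitsur X Y r),
    (∀ x, s 0 (M.amitsurCoboundary X Y 0 x) = x) ∧
    ∀ (r : ℕ) (x), s (r + 1) (M.amitsurCoboundary X Y (r + 1) x) +
      M.amitsurCoboundary X Y r (s r x) = x

/-- `M` is `X`-computable: for every finite `G`-set `Y` both Amitsur complexes of `M` on `(X, Y)`
are contractible. -/
def Computable (M : MackeyFunctor.{u, v} G) (X : FinGSet G) : Prop :=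
  ∀ Y : FinGSet G, M.AmitsurContractible X Y ∧ M.CoAmitsurContractible X Y

end MackeyFunctor

/-! ### Families of subgroups -/

/-- A family of subgroups: closed under conjugation and under passing to subgroups. -/
structure SubgroupFamily (G : Type u) [Group G] where
  carrier : Set (Subgroup G)
  conj_mem : ∀ (g : G) (H : Subgroup G), H ∈ carrier →
    H.map (MulAut.conj g).toMonoidHom ∈ carrier
  le_mem : ∀ H K : Subgroup G, H ∈ carrier → K ≤ H → K ∈ carrier

/-- `O^p(H)`, the intersection of the normal subgroups of `H` with quotient a `p`-group. -/
def pResidual (p : ℕ) (H : Type u) [Group H] : Subgroup H :=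
  sInf {N : Subgroup H | ∃ _ : N.Normal, IsPGroup p (H ⧸ N)}

namespace SubgroupFamily

variable {G : Type u} [Group G]

/-- `hyper_p-ℱ`: the subgroups `H ≤ G` with `O^p(H) ∈ ℱ`. -/
def hyper (p : ℕ) (ℱ : SubgroupFamily G) : Set (Subgroup G) :=
  {H | (pResidual p H).map H.subtype ∈ ℱ.carrier}

/-- `ℱ` is `hyper_p`-closed: `hyper_p-ℱ = ℱ`. -/
def HyperClosed (p : ℕ) (ℱ : SubgroupFamily G) : Prop :=
  ℱ.hyper p = ℱ.carrier

/-- The conjugacy classes of maximal elements of `ℱ` (under inclusion), as a type. -/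
def MaxClass (ℱ : SubgroupFamily G) : Type u :=
  {c : MulAction.orbitRel.Quotient (ConjAct G) (Subgroup G) //
    ∃ H : Subgroup G, Maximal (· ∈ ℱ.carrier) H ∧ Quotient.mk'' H = c}

instance [Finite G] (ℱ : SubgroupFamily G) : Finite ℱ.MaxClass :=
  haveI : Finite (MulAction.orbitRel.Quotient (ConjAct G) (Subgroup G)) := Quotient.finite _
  Subtype.finite

/-- A maximal element of `ℱ` chosen in the given conjugacy class. -/
noncomputable def MaxClass.rep {ℱ : SubgroupFamily G} (c : ℱ.MaxClass) : Subgroup G :=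
  c.2.choose

/-- The finite `G`-set `X(ℱ)`: the disjoint union of the `G/H`, with one `H` for each conjugacy
class of maximal elements of `ℱ`. -/
noncomputable def gset [Finite G] (ℱ : SubgroupFamily G) : FinGSet G :=
  ⟨Σ c : ℱ.MaxClass, G ⧸ c.rep⟩

/-- The members of `ℱ`, as a finset. -/
noncomputable def members [Finite G] (ℱ : SubgroupFamily G) : Finset (Subgroup G) :=
  (Set.toFinite ℱ.carrier).toFinset

end SubgroupFamily

/-- `M` is `ℱ`-computable, i.e. `X(ℱ)`-computable. -/
def MackeyFunctor.FamilyComputable {G : Type u} [Group G] [Finite G]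
    (M : MackeyFunctor.{u, v} G) (ℱ : SubgroupFamily G) : Prop :=
  M.Computable ℱ.gset

/-! Put `R = ZAtPrime p` and `Γ = 𝒢 ⊗ R`. A finite `G`-set `S` acts on any Green module over `Γ`,
through its Burnside class in `Γ(•)`, as restriction to `S` followed by induction. It therefore
suffices to write the unit of `Γ(•)` as an `R`-combination of the classes of `G/H` with `H ∈ ℱ`.

The `R`-span of the classes of `G`-sets with isotropy in `ℱ` is closed under products, so the
elements congruent to 1 modulo this span are closed under products too. Suppose such an `e`
restricts to zero on every `G/H`, `H ∈ ℱ`. Computability writes 1 as a transfer from `X(ℱ)`, and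
Frobenius reciprocity makes `e = e · 1` the transfer of a multiple of a restriction of `e`. So `e =
0` and 1 lies in the span (`GreenRing.one_mem_isotropySpan`).

Such an `e` is built as a product, by induction on the order of `K ∈ ℱ`
(`GreenRing.exists_one_sub_mem_pull_quot_eq_zero`). If `e` already vanishes on smaller members, then
on the restriction of `e` to `G/K` the class of `G/P` acts as the scalar `|(G/P)^K|`, since the
other orbits of `G/K × G/P` contribute nothing. If this scalar is a unit `u`, the factor `1 -
u⁻¹[G/P]` kills the restriction.

Hyper-closedness supplies a `P ∈ ℱ` with `|(G/P)^K|` prime to `p`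
(`SubgroupFamily.HyperClosed.exists_not_dvd_card_fixedBy`): replace `K` by a `p`-perfect subgroup
`L` with the same marks modulo `p`, and let `P/L` be a Sylow `p`-subgroup of `N(L)/L`. -/

section

variable {G : Type u} [Group G]

/-! ### Marks of finite `G`-sets modulo `p` -/

/-- The points of a `G`-set that are fixed by the subgroup `K`. -/
def fixedBy (K : Subgroup G) (S : Type*) [MulAction G S] : Set S :=
  {s | K ≤ MulAction.stabilizer G s}

/-- A group is `p`-perfect if it has no nontrivial quotient that is a `p`-group. -/
def IsPPerfect (p : ℕ) (L : Type*) [Group L] : Prop :=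
  ∀ N : Subgroup L, ∀ _ : N.Normal, IsPGroup p (L ⧸ N) → N = ⊤

/-- The `p`-group `K/N` acts on the `N`-fixed points with fixed set `S^K`, and all its other orbits
have size divisible by `p`. -/
theorem card_fixedBy_modEq (p : ℕ) [Fact p.Prime] [Finite G] (K : Subgroup G) (N : Subgroup K)
    [N.Normal] (hN : IsPGroup p (K ⧸ N)) (S : Type*) [Finite S] [MulAction G S] :
    Nat.card (fixedBy K S) ≡ Nat.card (fixedBy (N.map K.subtype) S) [MOD p] := by
  have fixed_iff : ∀ s : S, s ∈ fixedBy (N.map K.subtype) S ↔ ∀ n ∈ N, (n : G) • s = s := by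
    intro s
    simp only [fixedBy, Set.mem_ofPred_eq, Subgroup.map_le_iff_le_comap]
    exact Iff.rfl
  let Y : SubMulAction K S :=
    { carrier := fixedBy (N.map K.subtype) S
      smul_mem' := fun k s hs => by
        rw [fixed_iff] at hs ⊢
        intro n hn
        -- Since `k⁻¹nk` lies in `N` and fixes `s`, the element `n` fixes `k • s`.
        have h1 := hs _ (‹N.Normal›.conj_mem n hn k⁻¹)
        change (n : G) • ((k : G) • s) = (k : G) • s
        conv_rhs => rw [← h1]
        simp [mul_smul] }
  have hY : ∀ y : Y, ∀ n ∈ N, n • y = y := fun y n hn =>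
    Subtype.ext ((fixed_iff _).1 y.2 n hn)
  let f : K ⧸ N →* Equiv.Perm Y := QuotientGroup.lift N (MulAction.toPermHom K Y)
    (fun n hn => by ext y; exact congrArg Subtype.val (hY y n hn))
  let _ : MulAction (K ⧸ N) Y := MulAction.compHom Y f
  have key := hN.card_modEq_card_fixedPoints Y
  have e : Nat.card (fixedBy K S) = Nat.card (MulAction.fixedPoints (K ⧸ N) Y) := by
    refine Nat.card_congr
      { toFun := fun s => ⟨⟨s.1, (fixed_iff _).2 fun n _ => s.2 n.2⟩, ?_⟩
        invFun := fun y => ⟨y.1.1, ?_⟩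
        left_inv := fun _ => rfl
        right_inv := fun _ => rfl }
    · intro q
      obtain ⟨k, rfl⟩ := QuotientGroup.mk_surjective q
      exact Subtype.ext (s.2 k.2)
    · intro k hk
      exact congrArg Subtype.val (y.2 (QuotientGroup.mk (⟨k, hk⟩ : K)))
  rw [e]
  exact key.symm

/-- Keep passing to a proper normal subgroup with `p`-group quotient; finiteness stops the descent,
and each stage preserves marks modulo `p`. One `L` serves for all `S`. -/
theorem exists_isPPerfect_card_fixedBy_modEq (p : ℕ) [Fact p.Prime] [Finite G] (K : Subgroup G) :
    ∃ L ≤ K, IsPPerfect p L ∧ ∀ (S : Type u) [Finite S] [MulAction G S],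
      Nat.card (fixedBy K S) ≡ Nat.card (fixedBy L S) [MOD p] := by
  induction K using WellFoundedLT.induction with
  | ind K ih =>
  by_cases hK : IsPPerfect p K
  · exact ⟨K, le_rfl, hK, fun S _ _ => rfl⟩
  · unfold IsPPerfect at hK
    push Not at hK
    obtain ⟨N, hN, hp, hne⟩ := hK
    have hle : N.map K.subtype ≤ K := Subgroup.map_subtype_le N
    have hlt : N.map K.subtype < K := by
      refine lt_of_le_of_ne hle fun h => hne ?_
      rw [eq_top_iff]
      intro k _
      have hk : (k : G) ∈ N.map K.subtype := by
        rw [h]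
        exact k.2
      obtain ⟨n, hn, hnk⟩ := hk
      rwa [← Subtype.ext hnk]
    obtain ⟨L, hL, hperf, hcard⟩ := ih _ hlt
    exact ⟨L, hL.trans hle, hperf, fun S _ _ => (card_fixedBy_modEq p K N hp S).trans (hcard S)⟩

/-- Take `P/L` Sylow in `N(L)/L`. As `P/L` is a `p`-group, `O^p(P) ≤ L`. If `L` fixes `gP`, then
`g⁻¹Lg ≤ P`, and `p`-perfectness forces `g⁻¹Lg ≤ L`. Hence the fixed points are `N(L)/P`, whose size
is the index of a Sylow subgroup. -/
theorem IsPPerfect.exists_not_dvd_card_fixedBy {p : ℕ} [Fact p.Prime] [Finite G] {L : Subgroup G}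
    (hL : IsPPerfect p L) :
    ∃ P : Subgroup G, (pResidual p P).map P.subtype ≤ L ∧
      ¬ p ∣ Nat.card (fixedBy L (G ⧸ P)) := by
  let N := Subgroup.normalizer (L : Set G)
  let LN := L.subgroupOf N
  have : LN.Normal := Subgroup.normal_in_normalizer
  obtain ⟨Q⟩ : Nonempty (Sylow p (N ⧸ LN)) := inferInstance
  let P' : Subgroup N := (Q : Subgroup (N ⧸ LN)).comap (QuotientGroup.mk' LN)
  let P : Subgroup G := P'.map N.subtype
  have hpow : ∀ n ∈ P', ∃ k : ℕ, (n : G) ^ p ^ k ∈ L := by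
    intro n hn
    obtain ⟨k, hk⟩ := Q.isPGroup' ⟨QuotientGroup.mk' LN n, hn⟩
    refine ⟨k, ?_⟩
    have h := congrArg Subtype.val hk
    have h2 : (QuotientGroup.mk' LN (n ^ p ^ k)) = 1 := by rw [map_pow]; exact h
    rw [QuotientGroup.mk'_apply, QuotientGroup.eq_one_iff] at h2
    exact h2
  have hPN : P ≤ N := Subgroup.map_subtype_le P'
  refine ⟨P, ?_, ?_⟩
  · rw [Subgroup.map_le_iff_le_comap]
    have hn : (L.subgroupOf P).Normal := Subgroup.normal_subgroupOf_of_le_normalizer hPN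
    refine sInf_le ⟨hn, ?_⟩
    intro q
    obtain ⟨x, rfl⟩ := QuotientGroup.mk_surjective q
    obtain ⟨n, hn, hnx⟩ := x.2
    obtain ⟨k, hk⟩ := hpow n hn
    refine ⟨k, ?_⟩
    refine (QuotientGroup.eq_one_iff (N := L.subgroupOf P) (x ^ p ^ k)).2 ?_
    rw [Subgroup.mem_subgroupOf, Subgroup.coe_pow, ← hnx]
    exact hk
  · have hfix : fixedBy L (G ⧸ P) = MulAction.orbit N ((1 : G) : G ⧸ P) := by
      ext y
      constructor
      · intro hy
        obtain ⟨g, rfl⟩ := QuotientGroup.mk_surjective y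
        have hP : ∀ l ∈ L, g⁻¹ * l * g ∈ P := by
          intro l hl
          have h : ((l * g : G) : G ⧸ P) = (g : G ⧸ P) := hy hl
          have h' := QuotientGroup.eq.1 h.symm
          rwa [← mul_assoc] at h'
        -- Conjugation by `g⁻¹` followed by reduction modulo `L` lands in the `p`-group `Q`, so
        -- `p`-perfectness makes it trivial.
        let ψ : L →* N ⧸ LN := (QuotientGroup.mk' LN).comp
          { toFun := fun l => ⟨g⁻¹ * l * g, hPN (hP l l.2)⟩
            map_one' := Subtype.ext (by simp)
            map_mul' := fun a b => Subtype.ext (by simp [mul_assoc]) }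
        have hrange : ψ.range ≤ (Q : Subgroup (N ⧸ LN)) := by
          rintro _ ⟨l, rfl⟩
          obtain ⟨n, hn, hnl⟩ := hP l l.2
          have : (⟨g⁻¹ * l * g, hPN (hP l l.2)⟩ : N) = n := Subtype.ext hnl.symm
          change QuotientGroup.mk' LN ⟨g⁻¹ * l * g, hPN (hP l l.2)⟩ ∈ (Q : Subgroup (N ⧸ LN))
          rw [this]
          exact hn
        have hker : ψ.ker = ⊤ := hL ψ.ker inferInstance
          ((Q.isPGroup'.to_le hrange).of_equiv (QuotientGroup.quotientKerEquivRange ψ).symm)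
        have hconj : ∀ l ∈ L, g⁻¹ * l * g ∈ L := by
          intro l hl
          have h : (⟨l, hl⟩ : L) ∈ ψ.ker := hker ▸ Subgroup.mem_top _
          exact (QuotientGroup.eq_one_iff (N := LN) ⟨g⁻¹ * l * g, hPN (hP l hl)⟩).1 h
        have hg : g⁻¹ ∈ N := by
          -- Equal finite orders turn the inclusion `g⁻¹Lg ≤ L` into an equality.
          have hmap : L.map (MulAut.conj g⁻¹).toMonoidHom = L := by
            refine Subgroup.eq_of_le_of_card_ge ?_ (le_of_eq ?_)
            · rintro _ ⟨l, hl, rfl⟩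
              simpa using hconj l hl
            · exact (Nat.card_congr (L.equivMapOfInjective _
                (MulAut.conj g⁻¹).injective).toEquiv)
          rw [Subgroup.mem_normalizer_iff]
          intro h
          constructor
          · intro hh
            simpa using hconj h hh
          · intro hh
            rw [← hmap] at hh
            obtain ⟨l, hl, hlh⟩ := hh
            have : l = h := by simpa using hlh
            exact this ▸ hl
        refine ⟨⟨g, by simpa using N.inv_mem hg⟩, ?_⟩
        change ((g * 1 : G) : G ⧸ P) = _
        rw [mul_one]
      · rintro ⟨n, rfl⟩ l hl
        change ((l * (n * 1) : G) : G ⧸ P) = ((n * 1 : G) : G ⧸ P)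
        rw [mul_one]
        symm
        rw [QuotientGroup.eq]
        have h1 : (n : G)⁻¹ * l * n ∈ L := by
          have := (Subgroup.mem_normalizer_iff.1 (N.inv_mem n.2) l).1 hl
          simpa using this
        have h2 : (n : G)⁻¹ * l * n ∈ N := Subgroup.le_normalizer h1
        rw [← mul_assoc]
        refine ⟨⟨_, h2⟩, ?_, rfl⟩
        change QuotientGroup.mk' LN _ ∈ (Q : Subgroup (N ⧸ LN))
        rw [QuotientGroup.mk'_apply, (QuotientGroup.eq_one_iff (N := LN) ⟨_, h2⟩).2 h1]
        exact one_mem _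
    have hstab : MulAction.stabilizer N ((1 : G) : G ⧸ P) = P' := by
      ext n
      have : n ∈ MulAction.stabilizer N ((1 : G) : G ⧸ P) ↔
        ((n * 1 : G) : G ⧸ P) = ((1 : G) : G ⧸ P) := Iff.rfl
      rw [this, mul_one, eq_comm, QuotientGroup.eq, inv_one, one_mul]
      constructor
      · rintro ⟨m, hm, hmn⟩
        rwa [← Subtype.ext hmn]
      · exact fun h => ⟨n, h, rfl⟩
    rw [hfix, Nat.card_coe_set_eq, ← MulAction.index_stabilizer, hstab,
      Subgroup.index_comap_of_surjective _ (QuotientGroup.mk'_surjective LN)]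
    exact Q.not_dvd_index

/-- From `O^p(P) ≤ L ≤ K ∈ ℱ` it follows that `P` is in `hyper_p-ℱ = ℱ`; the marks of `G/P` at `K`
and `L` agree modulo `p`. -/
theorem SubgroupFamily.HyperClosed.exists_not_dvd_card_fixedBy {p : ℕ} [Fact p.Prime] [Finite G]
    {ℱ : SubgroupFamily G} (hℱ : ℱ.HyperClosed p) {K : Subgroup G} (hK : K ∈ ℱ.carrier) :
    ∃ P ∈ ℱ.carrier, ¬ p ∣ Nat.card (fixedBy K (G ⧸ P)) := by
  obtain ⟨L, hLK, hL, hcard⟩ := exists_isPPerfect_card_fixedBy_modEq p K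
  obtain ⟨P, hP, hdvd⟩ := hL.exists_not_dvd_card_fixedBy
  refine ⟨P, ?_, fun h => hdvd (((hcard (G ⧸ P)).dvd_iff dvd_rfl).1 h)⟩
  rw [← hℱ]
  exact ℱ.le_mem L _ (ℱ.le_mem K L hK hLK) hP

/-! ### Orbit decompositions -/

namespace FinGSet

/-- The maps `i : A → S` and `j : B → S` exhibit `S` as the disjoint union of `A` and `B`. -/
def IsCoproduct {A B S : FinGSet G} (i : A →[G] S) (j : B →[G] S) : Prop :=
  Function.Bijective (Sum.elim i j)

/-- Finite `G`-sets are built from the empty one by adding transitive ones. -/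
theorem orbit_induction {C : FinGSet G → Prop} (empty : ∀ S : FinGSet G, IsEmpty S → C S)
    (transitive : ∀ S : FinGSet G, Nonempty S → MulAction.IsPretransitive G S → C S)
    (coproduct : ∀ (A B S : FinGSet G) (i : A →[G] S) (j : B →[G] S), IsCoproduct i j →
      C A → C B → C S) (S : FinGSet G) : C S := by
  induction h : Nat.card S using Nat.strong_induction_on generalizing S with
  | _ n ih =>
  subst h
  rcases isEmpty_or_nonempty S with hS | ⟨⟨s⟩⟩
  · exact empty S hS
  let A : FinGSet G := ⟨MulAction.orbit G s⟩
  let B' : SubMulAction G S :=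
    { carrier := (MulAction.orbit G s)ᶜ
      smul_mem' := fun g x hx hg => by
        obtain ⟨a, ha⟩ := hg
        exact hx ⟨g⁻¹ * a, by simp only [mul_smul] at ha ⊢; rw [ha, inv_smul_smul]⟩ }
  let B : FinGSet G := ⟨B'⟩
  let i : A →[G] S := ⟨Subtype.val, fun _ _ => rfl⟩
  let j : B →[G] S := ⟨Subtype.val, fun _ _ => rfl⟩
  have hij : IsCoproduct i j := by
    constructor
    · rintro (a | a) (b | b) hab
      · exact congrArg Sum.inl (Subtype.ext hab)
      · exact absurd (show a.1 = b.1 from hab) fun h => b.2 (h ▸ a.2)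
      · exact absurd (show a.1 = b.1 from hab) fun h => a.2 (h ▸ b.2)
      · exact congrArg Sum.inr (Subtype.ext hab)
    · intro x
      by_cases hx : x ∈ MulAction.orbit G s
      · exact ⟨Sum.inl ⟨x, hx⟩, rfl⟩
      · exact ⟨Sum.inr ⟨x, hx⟩, rfl⟩
  refine coproduct A B S i j hij (transitive A ⟨⟨s, MulAction.mem_orbit_self s⟩⟩
    (inferInstanceAs (MulAction.IsPretransitive G (MulAction.orbit G s)))) (ih _ ?_ B rfl)
  have hcard : Nat.card S = Nat.card A + Nat.card B := by
    rw [← Nat.card_sum, Nat.card_congr (Equiv.ofBijective _ hij)]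
  have : 0 < Nat.card A := Nat.card_pos_iff.2 ⟨⟨⟨s, MulAction.mem_orbit_self s⟩⟩, A.finite⟩
  omega

/-- The map `G/H → S` to a `G`-set from the orbit of a point with stabilizer `H`. -/
def ofPoint [Finite G] {S : FinGSet G} (s : S) : quot (MulAction.stabilizer G s) →[G] S where
  toFun := MulAction.ofQuotientStabilizer G s
  map_smul' g x := MulAction.ofQuotientStabilizer_smul G s g x

theorem ofPoint_bijective [Finite G] {S : FinGSet G} [MulAction.IsPretransitive G S] (s : S) :
    Function.Bijective (ofPoint s) := by
  refine ⟨MulAction.injective_ofQuotientStabilizer G s, fun t => ?_⟩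
  obtain ⟨g, rfl⟩ := MulAction.exists_smul_eq G s t
  exact ⟨(g : G ⧸ MulAction.stabilizer G s), rfl⟩

theorem toPoint_comp {S T : FinGSet G} (f : S →[G] T) : T.toPoint.comp f = S.toPoint := rfl

end FinGSet

/-! ### Restriction and induction along isomorphisms, coproducts and orbits. -/

namespace MackeyFunctor

variable (N : MackeyFunctor.{u, v} G)

open FinGSet

/-- A bijection `g` is the pullback of the identity of `T` along itself, so this is a case of the
double coset formula. The next two lemmas use the pullbacks of an injection along itself and of two
maps with disjoint images. -/
theorem push_pull_of_bijective {S T : FinGSet G} (g : S →[G] T) (hg : Function.Bijective g)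
    (x : N.obj T) : N.push g (N.pull g x) = x := by
  have h := N.pull_push g g (MulActionHom.id G : T →[G] T) (MulActionHom.id G)
    ⟨fun _ => rfl, fun s₁ s₂ h => by
      obtain rfl : s₁ = s₂ := h
      obtain ⟨s, rfl⟩ := hg.2 s₁
      exact ⟨s, ⟨rfl, rfl⟩, fun t ht => hg.1 ht.1⟩⟩ x
  rw [← h, N.push_id, N.pull_id]

theorem pull_push_of_injective {S T : FinGSet G} (g : S →[G] T) (hg : Function.Injective g)
    (x : N.obj S) : N.pull g (N.push g x) = x := by
  have h := N.pull_push (MulActionHom.id G : S →[G] S) (MulActionHom.id G) g g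
    ⟨fun _ => rfl, fun s₁ s₂ h => by
      obtain rfl : s₁ = s₂ := hg h
      exact ⟨s₁, ⟨rfl, rfl⟩, fun t ht => ht.1⟩⟩ x
  rw [h, N.push_id, N.pull_id]

theorem pull_push_of_disjoint {A B S : FinGSet G} (i : A →[G] S) (j : B →[G] S)
    (h : ∀ a b, i a ≠ j b) (x : N.obj B) : N.pull i (N.push j x) = 0 := by
  let _ : MulAction G PEmpty.{u + 1} :=
    { smul := fun _ => nofun, one_smul := nofun, mul_smul := fun _ _ => nofun }
  let E : FinGSet G := ⟨PEmpty.{u + 1}⟩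
  have hE := N.empty E (inferInstanceAs (IsEmpty PEmpty))
  rw [N.pull_push (⟨PEmpty.elim, fun _ x => x.elim⟩ : E →[G] A)
    (⟨PEmpty.elim, fun _ x => x.elim⟩ : E →[G] B) i j
    ⟨fun x => PEmpty.elim x, fun a b hab => absurd hab (h a b)⟩, Subsingleton.elim (N.pull _ x) 0,
    map_zero]

theorem pull_injective_of_bijective {S T : FinGSet G} (g : S →[G] T) (hg : Function.Bijective g) :
    Function.Injective (N.pull g) :=
  Function.LeftInverse.injective (N.push_pull_of_bijective g hg)

theorem eq_zero_of_isCoproduct {A B S : FinGSet G} {i : A →[G] S} {j : B →[G] S}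
    (h : IsCoproduct i j) {x : N.obj S} (hi : N.pull i x = 0) (hj : N.pull j x = 0) : x = 0 := by
  let e : A.sum B →[G] S := ⟨Sum.elim i j, by rintro g (a | b) <;> exact map_smul _ _ _⟩
  refine N.pull_injective_of_bijective e h ?_
  rw [map_zero]
  refine (N.additive A B).1 ?_
  rw [map_zero]
  refine Prod.ext ?_ ?_
  · exact (N.pull_comp (inl A B) e x).symm.trans hi
  · exact (N.pull_comp (inr A B) e x).symm.trans hj

theorem push_pull_add_push_pull {A B S : FinGSet G} {i : A →[G] S} {j : B →[G] S}
    (h : IsCoproduct i j) (x : N.obj S) :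
    N.push i (N.pull i x) + N.push j (N.pull j x) = x := by
  have hi : Function.Injective i := fun a b hab => Sum.inl_injective (h.1 hab)
  have hj : Function.Injective j := fun a b hab => Sum.inr_injective (h.1 hab)
  have hd : ∀ a b, i a ≠ j b := fun a b hab =>
    Sum.inl_ne_inr (h.1 (show Sum.elim i j (Sum.inl a) = Sum.elim i j (Sum.inr b) from hab))
  rw [← sub_eq_zero]
  refine N.eq_zero_of_isCoproduct h ?_ ?_
  · rw [map_sub, map_add, N.pull_push_of_injective i hi, N.pull_push_of_disjoint i j hd,
      add_zero, sub_self]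
  · rw [map_sub, map_add, N.pull_push_of_injective j hj,
      N.pull_push_of_disjoint j i (fun b a => (hd a b).symm), zero_add, sub_self]

theorem push_pull_coproduct {A B S T : FinGSet G} {i : A →[G] S} {j : B →[G] S}
    (h : IsCoproduct i j) (g : S →[G] T) (x : N.obj T) :
    N.push g (N.pull g x) = N.push (g.comp i) (N.pull (g.comp i) x) +
      N.push (g.comp j) (N.pull (g.comp j) x) := by
  rw [N.push_comp, N.push_comp, N.pull_comp, N.pull_comp, ← map_add, N.push_pull_add_push_pull h]

theorem push_pull_comp_of_bijective {S T U : FinGSet G} (e : S →[G] T)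
    (he : Function.Bijective e) (g : T →[G] U) (x : N.obj U) :
    N.push (g.comp e) (N.pull (g.comp e) x) = N.push g (N.pull g x) := by
  rw [N.push_comp, N.pull_comp, N.push_pull_of_bijective e he]

/-- An element that vanishes on all orbits vanishes. -/
theorem eq_zero_of_pull_ofPoint [Finite G] {S : FinGSet G} (x : N.obj S)
    (hx : ∀ s : S, N.pull (ofPoint s) x = 0) : x = 0 := by
  induction S using orbit_induction with
  | empty S hS =>
    have := N.empty S hS
    exact Subsingleton.elim _ _
  | transitive S hS hT =>
    obtain ⟨s⟩ := hS
    refine N.pull_injective_of_bijective _ (ofPoint_bijective s) ?_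
    rw [hx, map_zero]
  | coproduct A B S i j h hA hB =>
    have key : ∀ (C : FinGSet G) (k : C →[G] S), Function.Injective k → ∀ c : C,
        N.pull (ofPoint c) (N.pull k x) = 0 := by
      intro C k hk c
      have hle : MulAction.stabilizer G c ≤ MulAction.stabilizer G (k c) := fun g hg => by
        rw [MulAction.mem_stabilizer_iff] at hg ⊢
        rw [← map_smul, hg]
      -- The orbit map of `c`, followed by `k`, factors through the orbit map of `k c`, where the
      -- hypothesis applies.
      let f : quot (MulAction.stabilizer G c) →[G] quot (MulAction.stabilizer G (k c)) :=
        ⟨Subgroup.quotientMapOfLE hle, by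
          intro g q
          obtain ⟨q, rfl⟩ := QuotientGroup.mk_surjective q
          rfl⟩
      have hf : k.comp (ofPoint c) = (ofPoint (k c)).comp f := by
        ext q
        obtain ⟨q, rfl⟩ := QuotientGroup.mk_surjective q
        exact map_smul k q c
      rw [← N.pull_comp, hf, N.pull_comp, hx, map_zero]
    refine N.eq_zero_of_isCoproduct h (hA _ (key A i ?_)) (hB _ (key B j ?_))
    · exact fun a b hab => Sum.inl_injective (h.1 hab)
    · exact fun a b hab => Sum.inr_injective (h.1 hab)

/-- Let `T` be transitive and `g : S → T`. If `c ∈ N(T)` restricts to zero on the orbits of `S` whose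
isotropy is smaller than that of `T`, then `g_* g^* c` is a multiple of `c`. -/
theorem push_pull_eq_card_nsmul {T : FinGSet G} (t₀ : T) [MulAction.IsPretransitive G T]
    (c : N.obj T) {S : FinGSet G} (g : S →[G] T)
    (hc : ∀ s : S, MulAction.stabilizer G s ≠ MulAction.stabilizer G (g s) →
      ∀ (A : FinGSet G) (i : A →[G] S), MulAction.IsPretransitive G A → s ∈ Set.range i →
        N.pull (g.comp i) c = 0) :
    N.push g (N.pull g c) = Nat.card {s : S // g s = t₀ ∧
      MulAction.stabilizer G s = MulAction.stabilizer G t₀} • c := by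
  induction S using orbit_induction with
  | empty S hS =>
    have := N.empty S hS
    rw [Subsingleton.elim (N.pull g c) 0, map_zero, Nat.card_of_isEmpty, zero_smul]
  | transitive S hS hT =>
    obtain ⟨s, hs⟩ : ∃ s, g s = t₀ := by
      obtain ⟨s⟩ := hS
      obtain ⟨a, ha⟩ := MulAction.exists_smul_eq G (g s) t₀
      exact ⟨a • s, by rw [map_smul, ha]⟩
    -- With equal isotropy `g` is an isomorphism and contributes `c` once; otherwise `g^* c = 0` and
    -- the orbit has no point to count.
    by_cases hst : MulAction.stabilizer G s = MulAction.stabilizer G (g s)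
    · have hinj : Function.Injective g := by
        have hs' : ∀ x, g x = g s → x = s := by
          intro x hx
          obtain ⟨a, rfl⟩ := MulAction.exists_smul_eq G s x
          rw [map_smul] at hx
          exact MulAction.mem_stabilizer_iff.1 (hst ▸ MulAction.mem_stabilizer_iff.2 hx)
        intro x y hxy
        obtain ⟨a, ha⟩ := MulAction.exists_smul_eq G y s
        have h1 : a • x = s := hs' _ (by rw [map_smul, hxy, ← map_smul, ha])
        exact MulAction.injective a (h1.trans ha.symm)
      have hbij : Function.Bijective g := by
        refine ⟨hinj, fun t => ?_⟩
        obtain ⟨a, rfl⟩ := MulAction.exists_smul_eq G t₀ t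
        exact ⟨a • s, by rw [map_smul, hs]⟩
      have hcard : Nat.card {s : S // g s = t₀ ∧
          MulAction.stabilizer G s = MulAction.stabilizer G t₀} = 1 := by
        rw [Nat.card_eq_one_iff_unique]
        exact ⟨⟨fun x y => Subtype.ext (hinj (x.2.1.trans y.2.1.symm))⟩,
          ⟨⟨s, hs, hst.trans (by rw [hs])⟩⟩⟩
      rw [N.push_pull_of_bijective g hbij, hcard, one_smul]
    · have h0 := hc s hst S (MulActionHom.id G) hT ⟨s, rfl⟩
      have h1 : N.pull g c = 0 := h0
      have hcard : Nat.card {s : S // g s = t₀ ∧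
          MulAction.stabilizer G s = MulAction.stabilizer G t₀} = 0 := by
        rw [Nat.card_eq_zero]
        left
        -- Equality of stabilizers at one point of the orbit would propagate to `s` by conjugation.
        refine ⟨fun ⟨x, hx, hxs⟩ => hst ?_⟩
        obtain ⟨a, rfl⟩ := MulAction.exists_smul_eq G x s
        rw [map_smul, MulAction.stabilizer_smul_eq_stabilizer_map_conj, hxs,
          MulAction.stabilizer_smul_eq_stabilizer_map_conj, hx]
      rw [h1, map_zero, hcard, zero_smul]
  | coproduct A B S i j h hA hB =>
    have hi : Function.Injective i := fun a b hab => Sum.inl_injective (h.1 hab)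
    have hj : Function.Injective j := fun a b hab => Sum.inr_injective (h.1 hab)
    have hstab : ∀ {C : FinGSet G} (k : C →[G] S), Function.Injective k → ∀ x : C,
        MulAction.stabilizer G (k x) = MulAction.stabilizer G x := by
      intro C k hk x
      ext a
      rw [MulAction.mem_stabilizer_iff, MulAction.mem_stabilizer_iff, ← map_smul, hk.eq_iff]
    rw [N.push_pull_coproduct h g, hA (g.comp i) ?_, hB (g.comp j) ?_, ← add_smul, ← Nat.card_sum]
    · congr 1
      let P : A ⊕ B → Prop := fun x => g (Sum.elim i j x) = t₀ ∧
        MulAction.stabilizer G (Sum.elim i j x) = MulAction.stabilizer G t₀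
      have eA : ∀ a, (g.comp i a = t₀ ∧ MulAction.stabilizer G a = MulAction.stabilizer G t₀) ↔
          P (Sum.inl a) := fun a => by rw [← hstab i hi]; rfl
      have eB : ∀ b, (g.comp j b = t₀ ∧ MulAction.stabilizer G b = MulAction.stabilizer G t₀) ↔
          P (Sum.inr b) := fun b => by rw [← hstab j hj]; rfl
      exact Nat.card_congr (((Equiv.subtypeEquivRight eA).sumCongr
        (Equiv.subtypeEquivRight eB)).trans ((Equiv.subtypeSum (p := P)).symm.trans
          ((Equiv.ofBijective _ h).subtypeEquiv fun _ => Iff.rfl)))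
    -- Maps into a summand compose to maps into `S`; testing `c` on arbitrary transitive `A → S`
    -- makes the hypothesis inherited by summands.
    · intro s hs C k hC hsk
      refine hc (j s) ?_ C (j.comp k) hC ?_
      · rwa [hstab j hj]
      · obtain ⟨a, rfl⟩ := hsk
        exact ⟨a, rfl⟩
    · intro s hs C k hC hsk
      refine hc (i s) ?_ C (i.comp k) hC ?_
      · rwa [hstab i hi]
      · obtain ⟨a, rfl⟩ := hsk
        exact ⟨a, rfl⟩

end MackeyFunctor

/-! ### Linear Green rings -/

/-- The values of the Green ring `Γ` are `R`-algebras and its structure maps are `R`-linear. -/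
class GreenRing.IsLinear (R : Type*) [CommRing R] (Γ : GreenRing.{u, v} G)
    [∀ S, Module R (Γ.functor.obj S)] : Prop where
  push_smul : ∀ {S T : FinGSet G} (φ : S →[G] T) (r : R) (x : Γ.functor.obj S),
    Γ.functor.push φ (r • x) = r • Γ.functor.push φ x
  pull_smul : ∀ {S T : FinGSet G} (φ : S →[G] T) (r : R) (x : Γ.functor.obj T),
    Γ.functor.pull φ (r • x) = r • Γ.functor.pull φ x
  smul_mul : ∀ {S : FinGSet G} (r : R) (x y : Γ.functor.obj S),
    Γ.pairing.mul S (r • x) y = r • Γ.pairing.mul S x y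
  mul_smul : ∀ {S : FinGSet G} (r : R) (x y : Γ.functor.obj S),
    Γ.pairing.mul S x (r • y) = r • Γ.pairing.mul S x y

/-! ### Isotropy in a family of subgroups. -/

namespace FinGSet

/-- The first projection `S × T → S`. -/
def fst (S T : FinGSet G) : S.prod T →[G] S where
  toFun x := x.1
  map_smul' _ _ := rfl

/-- All isotropy groups of `S` belong to the family `ℱ`. -/
def IsotropyIn (ℱ : SubgroupFamily G) (S : FinGSet G) : Prop :=
  ∀ s : S, MulAction.stabilizer G s ∈ ℱ.carrier

theorem IsotropyIn.of_hom {ℱ : SubgroupFamily G} {S T : FinGSet G} (hT : T.IsotropyIn ℱ)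
    (f : S →[G] T) : S.IsotropyIn ℱ := fun s =>
  ℱ.le_mem _ _ (hT (f s)) fun g hg => by
    rw [MulAction.mem_stabilizer_iff] at hg ⊢
    rw [← map_smul, hg]

theorem stabilizer_quot_mk (H : Subgroup G) (g : G) :
    MulAction.stabilizer G (g : G ⧸ H) = H.map (MulAut.conj g).toMonoidHom := by
  have h : (g : G ⧸ H) = g • ((1 : G) : G ⧸ H) := by
    rw [MulAction.Quotient.smul_coe, smul_eq_mul, mul_one]
  rw [h, MulAction.stabilizer_smul_eq_stabilizer_map_conj, MulAction.stabilizer_quotient]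

theorem isotropyIn_quot [Finite G] {ℱ : SubgroupFamily G} {H : Subgroup G} (hH : H ∈ ℱ.carrier) :
    (quot H).IsotropyIn ℱ := by
  intro s
  obtain ⟨g, rfl⟩ := QuotientGroup.mk_surjective s
  rw [stabilizer_quot_mk]
  exact ℱ.conj_mem g H hH

theorem isotropyIn_gset [Finite G] (ℱ : SubgroupFamily G) : ℱ.gset.IsotropyIn ℱ := by
  rintro ⟨c, s⟩
  refine ℱ.le_mem _ _ (isotropyIn_quot (H := c.rep) c.2.choose_spec.1.prop s) fun g hg => ?_
  exact eq_of_heq (Sigma.mk.inj hg).2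

end FinGSet

/-! ### Burnside classes and the unit of a Green ring. -/

namespace GreenRing

open FinGSet

variable (Γ : GreenRing.{u, v} G)

/-- The image in `Γ(•)` of the class of `S` in the Burnside ring. -/
def burnside (S : FinGSet G) : Γ.functor.obj (point G) :=
  Γ.functor.push S.toPoint (Γ.one S)

theorem burnside_eq_push_pull (S : FinGSet G) :
    Γ.burnside S = Γ.functor.push S.toPoint (Γ.functor.pull S.toPoint (Γ.one _)) := by
  rw [Γ.pull_one, burnside]

theorem pull_burnside (S T : FinGSet G) :
    Γ.functor.pull S.toPoint (Γ.burnside T) = Γ.functor.push (fst S T) (Γ.one _) := by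
  rw [burnside, Γ.functor.pull_push (fst S T) (snd S T) S.toPoint T.toPoint, Γ.pull_one]
  exact ⟨fun _ => rfl, fun s t _ => ⟨(s, t), ⟨rfl, rfl⟩, fun x hx => Prod.ext hx.1 hx.2⟩⟩

theorem burnside_mul (S T : FinGSet G) :
    Γ.pairing.mul _ (Γ.burnside S) (Γ.burnside T) = Γ.burnside (S.prod T) := by
  rw [burnside, Γ.pairing.push_mul, Γ.one_mul, pull_burnside, ← Γ.functor.push_comp, toPoint_comp,
    burnside]

variable (R : Type*) [CommRing R] [∀ S, Module R (Γ.functor.obj S)]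

/-- The submodule of `Γ(•)` generated by the finite `G`-sets with isotropy in `ℱ`. -/
def isotropySpan (ℱ : SubgroupFamily G) : Submodule R (Γ.functor.obj (point G)) :=
  Submodule.span R {x | ∃ S : FinGSet G, S.IsotropyIn ℱ ∧ Γ.burnside S = x}

variable {R}

theorem burnside_mem_isotropySpan {ℱ : SubgroupFamily G} {S : FinGSet G} (hS : S.IsotropyIn ℱ) :
    Γ.burnside S ∈ Γ.isotropySpan R ℱ :=
  Submodule.subset_span ⟨S, hS, rfl⟩

/-- The Burnside class is additive on coproducts, and a transitive set is `G/H` for `H` one of its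
stabilizers. -/
theorem isotropySpan_le_span_quot [Finite G] (ℱ : SubgroupFamily G) :
    Γ.isotropySpan R ℱ ≤
      Submodule.span R ((fun H : Subgroup G => Γ.burnside (quot H)) '' ℱ.carrier) := by
  refine Submodule.span_le.2 ?_
  rintro _ ⟨S, hS, rfl⟩
  induction S using orbit_induction with
  | empty S _ =>
    have := Γ.functor.empty S ‹_›
    rw [burnside, Subsingleton.elim (Γ.one S) 0, map_zero]
    exact zero_mem _
  | transitive S hne hT =>
    obtain ⟨s⟩ := hne
    refine Submodule.subset_span ⟨_, hS s, ?_⟩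
    change Γ.burnside _ = Γ.burnside _
    rw [burnside_eq_push_pull, burnside_eq_push_pull, ← toPoint_comp (ofPoint s),
      Γ.functor.push_pull_comp_of_bijective _ (ofPoint_bijective s)]
  | coproduct A B S i j h hA hB =>
    rw [burnside_eq_push_pull, Γ.functor.push_pull_coproduct h, toPoint_comp, toPoint_comp,
      ← burnside_eq_push_pull, ← burnside_eq_push_pull]
    exact add_mem (hA (hS.of_hom i)) (hB (hS.of_hom j))

variable [Γ.IsLinear R]

/-- On generators the product is the class of `S × T`, whose isotropy is in `ℱ` because it maps to
`S`. -/
theorem mul_mem_isotropySpan {ℱ : SubgroupFamily G} {x y : Γ.functor.obj (point G)}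
    (hx : x ∈ Γ.isotropySpan R ℱ) (hy : y ∈ Γ.isotropySpan R ℱ) :
    Γ.pairing.mul _ x y ∈ Γ.isotropySpan R ℱ := by
  induction hx using Submodule.span_induction with
  | mem x hx =>
    obtain ⟨S, hS, rfl⟩ := hx
    induction hy using Submodule.span_induction with
    | mem y hy =>
      obtain ⟨T, hT, rfl⟩ := hy
      rw [burnside_mul]
      exact Γ.burnside_mem_isotropySpan (hS.of_hom (fst S T))
    | zero => rw [map_zero]; exact zero_mem _
    | add y z _ _ hy hz => rw [map_add]; exact add_mem hy hz
    | smul r y _ hy => rw [IsLinear.mul_smul]; exact Submodule.smul_mem _ r hy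
  | zero => rw [map_zero, AddMonoidHom.zero_apply]; exact zero_mem _
  | add x z _ _ hx hz => rw [map_add, AddMonoidHom.add_apply]; exact add_mem hx hz
  | smul r x _ hx => rw [IsLinear.smul_mul]; exact Submodule.smul_mem _ r hx

theorem one_sub_mul_mem {ℱ : SubgroupFamily G} {x y : Γ.functor.obj (point G)}
    (hx : Γ.one _ - x ∈ Γ.isotropySpan R ℱ) (hy : Γ.one _ - y ∈ Γ.isotropySpan R ℱ) :
    Γ.one _ - Γ.pairing.mul _ x y ∈ Γ.isotropySpan R ℱ := by
  have h : Γ.one _ - Γ.pairing.mul _ x y = (Γ.one _ - x) + (Γ.one _ - y) -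
      Γ.pairing.mul _ (Γ.one _ - x) (Γ.one _ - y) := by
    simp only [map_sub, AddMonoidHom.sub_apply, Γ.one_mul, Γ.mul_one]
    abel
  rw [h]
  exact sub_mem (add_mem hx hy) (Γ.mul_mem_isotropySpan hx hy)

variable [Finite G]

/-- Multiply the individual elements: restriction is multiplicative, so the product vanishes
wherever some factor does. -/
theorem exists_one_sub_mem_of_finset {ℱ : SubgroupFamily G} (T : Finset (Subgroup G))
    (h : ∀ H ∈ T, ∃ e, Γ.one _ - e ∈ Γ.isotropySpan R ℱ ∧
      Γ.functor.pull (quot H).toPoint e = 0) :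
    ∃ e, Γ.one _ - e ∈ Γ.isotropySpan R ℱ ∧ ∀ H ∈ T, Γ.functor.pull (quot H).toPoint e = 0 := by
  classical
  induction T using Finset.induction_on with
  | empty => exact ⟨Γ.one _, by rw [sub_self]; exact zero_mem _, by simp⟩
  | insert H T _ ih =>
    obtain ⟨e, he, heT⟩ := ih fun K hK => h K (Finset.mem_insert_of_mem hK)
    obtain ⟨f, hf, hfH⟩ := h H (Finset.mem_insert_self H T)
    refine ⟨Γ.pairing.mul _ e f, Γ.one_sub_mul_mem he hf, fun K hK => ?_⟩
    rw [Γ.pairing.pull_mul]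
    rcases Finset.mem_insert.1 hK with rfl | hK
    · rw [hfH, map_zero]
    · rw [heT K hK, map_zero, AddMonoidHom.zero_apply]

/-- The induction is on the order of `K`, not on inclusion, because the orbits of `G/K × G/P` have
isotropy in conjugates of `K`. -/
theorem exists_one_sub_mem_pull_quot_eq_zero {ℱ : SubgroupFamily G}
    (hℱ : ∀ K ∈ ℱ.carrier, ∃ P ∈ ℱ.carrier, IsUnit (Nat.card (fixedBy K (G ⧸ P)) : R))
    {K : Subgroup G} (hK : K ∈ ℱ.carrier) :
    ∃ e, Γ.one _ - e ∈ Γ.isotropySpan R ℱ ∧ Γ.functor.pull (quot K).toPoint e = 0 := by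
  classical
  induction h : Nat.card K using Nat.strong_induction_on generalizing K with
  | _ n ih =>
  subst h
  obtain ⟨e, he, he0⟩ := Γ.exists_one_sub_mem_of_finset (R := R) (ℱ := ℱ)
    (Set.toFinite {H | H ∈ ℱ.carrier ∧ Nat.card H < Nat.card K}).toFinset
    (fun H hH => by
      have hH := (Set.Finite.mem_toFinset _).1 hH
      exact ih _ hH.2 hH.1 rfl)
  obtain ⟨P, hP, u, hu⟩ := hℱ K hK
  let c := Γ.functor.pull (quot K).toPoint e
  -- An orbit with isotropy strictly below a conjugate of `K` is `G/H` with `H ∈ ℱ` of smaller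
  -- order, where `e` already vanishes.
  have key := Γ.functor.push_pull_eq_card_nsmul (T := quot K) ((1 : G) : G ⧸ K) c
    (fst (quot K) (quot P)) (by
      rintro s hs A i hA ⟨a, rfl⟩
      rw [← Γ.functor.pull_comp, toPoint_comp]
      refine Γ.functor.pull_injective_of_bijective _ (ofPoint_bijective a) ?_
      rw [← Γ.functor.pull_comp, toPoint_comp, map_zero]
      refine he0 _ ((Set.Finite.mem_toFinset _).2 ⟨?_, ?_⟩)
      · exact ((isotropyIn_quot hK).of_hom (fst (quot K) (quot P))).of_hom i a
      · have h1 : MulAction.stabilizer G a ≤ MulAction.stabilizer G (i a) := fun g hg => by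
          rw [MulAction.mem_stabilizer_iff] at hg ⊢
          rw [← map_smul, hg]
        have h2 : MulAction.stabilizer G (i a) <
            MulAction.stabilizer G (fst (quot K) (quot P) (i a)) :=
          lt_of_le_of_ne (fun g hg => by
            rw [MulAction.mem_stabilizer_iff] at hg ⊢
            rw [← map_smul, hg]) hs
        have h3 : Nat.card (MulAction.stabilizer G (fst (quot K) (quot P) (i a))) =
            Nat.card K := by
          obtain ⟨g, hg⟩ := QuotientGroup.mk_surjective (fst (quot K) (quot P) (i a))
          rw [← hg, stabilizer_quot_mk]
          exact (Nat.card_congr (K.equivMapOfInjective _ (MulAut.conj g).injective).toEquiv).symm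
        rw [← h3]
        refine Set.ncard_lt_ncard (lt_of_le_of_lt h1 h2) (Set.toFinite _))
  have hcard : Nat.card {s : (quot K).prod (quot P) // fst (quot K) (quot P) s = ((1 : G) : G ⧸ K) ∧
      MulAction.stabilizer G s = MulAction.stabilizer G ((1 : G) : G ⧸ K)} =
      Nat.card (fixedBy K (G ⧸ P)) := by
    -- The stabilizer of `(1·K, y)` is the intersection of `K` with that of `y`, so it equals `K`
    -- exactly when `K` fixes `y`.
    have hstab : ∀ s : (quot K).prod (quot P), fst (quot K) (quot P) s = ((1 : G) : G ⧸ K) →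
        (MulAction.stabilizer G s = K ↔ s.2 ∈ fixedBy K (G ⧸ P)) := by
      rintro ⟨x, y⟩ (rfl : x = _)
      have hx := MulAction.stabilizer_quotient K
      constructor
      · intro h g hg
        exact congrArg Prod.snd (MulAction.mem_stabilizer_iff.1 (h.symm ▸ hg))
      · intro h
        refine le_antisymm (fun g hg => ?_) fun g hg => ?_
        · rw [← hx]
          exact congrArg Prod.fst (MulAction.mem_stabilizer_iff.1 hg)
        · exact Prod.ext (hx.ge hg) (h hg)
    rw [MulAction.stabilizer_quotient]
    exact Nat.card_congr
      { toFun := fun s => ⟨s.1.2, (hstab s.1 s.2.1).1 s.2.2⟩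
        invFun := fun y => ⟨(((1 : G) : G ⧸ K), y.1), rfl, (hstab _ rfl).2 y.2⟩
        left_inv := fun s => Subtype.ext (Prod.ext s.2.1.symm rfl)
        right_inv := fun _ => rfl }
  rw [hcard] at key
  -- By `key`, multiplying `c` by the restriction of `[G/P]` scales it by `u`, so the new factor
  -- annihilates `c`.
  refine ⟨Γ.pairing.mul _ e (Γ.one _ - (↑u⁻¹ : R) • Γ.burnside (quot P)),
    Γ.one_sub_mul_mem he ?_, ?_⟩
  · rw [sub_sub_cancel]
    exact Submodule.smul_mem _ _ (Γ.burnside_mem_isotropySpan (isotropyIn_quot hP))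
  · rw [Γ.pairing.pull_mul, map_sub, map_sub, IsLinear.pull_smul, IsLinear.mul_smul,
      pull_burnside, Γ.pairing.mul_push, Γ.mul_one, key, Γ.pull_one, Γ.mul_one,
      ← Nat.cast_smul_eq_nsmul R, ← hu, smul_smul, Units.inv_mul, one_smul, sub_self]

/-- If the transfer from a `G`-set with isotropy in `ℱ` hits the unit, then the unit is a linear
combination of `G`-sets with isotropy in `ℱ`. -/
theorem one_mem_isotropySpan {ℱ : SubgroupFamily G}
    (hℱ : ∀ K ∈ ℱ.carrier, ∃ P ∈ ℱ.carrier, IsUnit (Nat.card (fixedBy K (G ⧸ P)) : R))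
    {S : FinGSet G} (hS : S.IsotropyIn ℱ) (y : Γ.functor.obj S)
    (hy : Γ.functor.push S.toPoint y = Γ.one _) : Γ.one _ ∈ Γ.isotropySpan R ℱ := by
  obtain ⟨e, he, he0⟩ := Γ.exists_one_sub_mem_of_finset (R := R) (ℱ := ℱ) ℱ.members
    (fun H hH => Γ.exists_one_sub_mem_pull_quot_eq_zero hℱ ((Set.Finite.mem_toFinset _).1 hH))
  have hpull : Γ.functor.pull S.toPoint e = 0 := by
    refine Γ.functor.eq_zero_of_pull_ofPoint _ fun s => ?_
    rw [← Γ.functor.pull_comp, toPoint_comp]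
    exact he0 _ ((Set.Finite.mem_toFinset _).2 (hS s))
  -- Frobenius reciprocity: `e = e · push y = push (pull e · y)`.
  have : e = 0 := by
    rw [← Γ.mul_one _ e, ← hy, Γ.pairing.mul_push, hpull, map_zero, AddMonoidHom.zero_apply,
      map_zero]
  rwa [this, sub_zero] at he

end GreenRing

/-! ### Extension of scalars for pairings and Green rings -/

namespace MackeyFunctor

@[elab_as_elim]
theorem extend_induction {M : MackeyFunctor.{u, v} G} {R : Type} [CommRing R] {S : FinGSet G}
    {C : (M.extend R).obj S → Prop}
    (x : (M.extend R).obj S) (zero : C 0) (add : ∀ x y, C x → C y → C (x + y))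
    (tmul : ∀ (r : R) (m : M.obj S), C (r ⊗ₜ[ℤ] m : R ⊗[ℤ] M.obj S)) : C x :=
  TensorProduct.induction_on x zero tmul add

variable (M : MackeyFunctor.{u, v} G) (R : Type) [CommRing R]

theorem extend_push_smul {S T : FinGSet G} (φ : S →[G] T) (r : R) (x : (M.extend R).obj S) :
    (M.extend R).push φ (r • x) = r • (M.extend R).push φ x := by
  induction x using MackeyFunctor.extend_induction with
  | zero => rw [smul_zero, map_zero, smul_zero]
  | add x y hx hy => rw [smul_add, map_add, hx, hy, map_add, smul_add]
  | tmul s x => rfl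

theorem extend_pull_smul {S T : FinGSet G} (φ : S →[G] T) (r : R) (x : (M.extend R).obj T) :
    (M.extend R).pull φ (r • x) = r • (M.extend R).pull φ x := by
  induction x using MackeyFunctor.extend_induction with
  | zero => rw [smul_zero, map_zero, smul_zero]
  | add x y hx hy => rw [smul_add, map_add, hx, hy, map_add, smul_add]
  | tmul s x => rfl

end MackeyFunctor

namespace MackeyPairing

variable {M : MackeyFunctor.{u, v} G} {N L : MackeyFunctor.{u, w} G} (P : MackeyPairing M N L)
  (R : Type) [CommRing R]

/-- The `R`-bilinear extension of a pairing on the value at `S`. -/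
noncomputable def extendMul (S : FinGSet G) :
    R ⊗[ℤ] M.obj S →ₗ[ℤ] R ⊗[ℤ] N.obj S →ₗ[ℤ] R ⊗[ℤ] L.obj S :=
  TensorProduct.map₂ (LinearMap.mul ℤ R)
    (LinearMap.mk₂ ℤ (fun x y => P.mul S x y) (by simp) (by simp) (by simp) (by simp))

/-- The pairing `(M ⊗ R) × (N ⊗ R) → L ⊗ R` induced by `M × N → L`. -/
noncomputable def extend : MackeyPairing (M.extend R) (N.extend R) (L.extend R) where
  mul S := AddMonoidHom.mk' (fun x => (P.extendMul R S x).toAddMonoidHom)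
    (fun x y => congrArg LinearMap.toAddMonoidHom (map_add (P.extendMul R S) x y))
  pull_mul φ x y := by
    induction x using MackeyFunctor.extend_induction with
    | zero => simp only [map_zero, AddMonoidHom.zero_apply]
    | add x z hx hz => simp only [map_add, AddMonoidHom.add_apply, hx, hz]
    | tmul r x =>
      induction y using MackeyFunctor.extend_induction with
      | zero => simp only [map_zero]
      | add y z hy hz => simp only [map_add, hy, hz]
      | tmul s y => exact congrArg ((r * s) ⊗ₜ[ℤ] ·) (P.pull_mul φ x y)
  mul_push φ x y := by
    induction x using MackeyFunctor.extend_induction with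
    | zero => simp only [map_zero, AddMonoidHom.zero_apply]
    | add x z hx hz => simp only [map_add, AddMonoidHom.add_apply, hx, hz]
    | tmul r x =>
      induction y using MackeyFunctor.extend_induction with
      | zero => simp only [map_zero]
      | add y z hy hz => simp only [map_add, hy, hz]
      | tmul s y => exact congrArg ((r * s) ⊗ₜ[ℤ] ·) (P.mul_push φ x y)
  push_mul φ x y := by
    induction x using MackeyFunctor.extend_induction with
    | zero => simp only [map_zero, AddMonoidHom.zero_apply]
    | add x z hx hz => simp only [map_add, AddMonoidHom.add_apply, hx, hz]
    | tmul r x =>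
      induction y using MackeyFunctor.extend_induction with
      | zero => simp only [map_zero]
      | add y z hy hz => simp only [map_add, hy, hz]
      | tmul s y => exact congrArg ((r * s) ⊗ₜ[ℤ] ·) (P.push_mul φ x y)

theorem extend_smul_mul {S : FinGSet G} (r : R) (x : (M.extend R).obj S)
    (y : (N.extend R).obj S) :
    (P.extend R).mul S (r • x) y = r • (P.extend R).mul S x y := by
  induction x using MackeyFunctor.extend_induction with
  | zero => simp only [smul_zero, map_zero, AddMonoidHom.zero_apply]
  | add x z hx hz => simp only [smul_add, map_add, AddMonoidHom.add_apply, hx, hz]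
  | tmul a x =>
    induction y using MackeyFunctor.extend_induction with
    | zero => simp only [smul_zero, map_zero]
    | add y z hy hz => simp only [smul_add, map_add, hy, hz]
    | tmul b y => exact congrArg (· ⊗ₜ[ℤ] P.mul S x y) (mul_assoc r a b)

theorem extend_mul_smul {S : FinGSet G} (r : R) (x : (M.extend R).obj S)
    (y : (N.extend R).obj S) :
    (P.extend R).mul S x (r • y) = r • (P.extend R).mul S x y := by
  induction x using MackeyFunctor.extend_induction with
  | zero => simp only [smul_zero, map_zero, AddMonoidHom.zero_apply]
  | add x z hx hz => simp only [smul_add, map_add, AddMonoidHom.add_apply, hx, hz]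
  | tmul a x =>
    induction y using MackeyFunctor.extend_induction with
    | zero => simp only [smul_zero, map_zero]
    | add y z hy hz => simp only [smul_add, map_add, hy, hz]
    | tmul b y => exact congrArg (· ⊗ₜ[ℤ] P.mul S x y) (mul_left_comm a r b)

end MackeyPairing

/-- The Green ring `𝒢 ⊗ R`. -/
noncomputable abbrev GreenRing.extend (𝒢 : GreenRing.{u, v} G) (R : Type) [CommRing R] :
    GreenRing.{u, v} G where
  functor := 𝒢.functor.extend R
  pairing := 𝒢.pairing.extend R
  one S := ((1 : R) ⊗ₜ[ℤ] 𝒢.one S : R ⊗[ℤ] 𝒢.functor.obj S)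
  mul_assoc S a b c := by
    induction a using MackeyFunctor.extend_induction with
    | zero => simp only [map_zero, AddMonoidHom.zero_apply]
    | add x z hx hz => simp only [map_add, AddMonoidHom.add_apply, hx, hz]
    | tmul r x =>
      induction b using MackeyFunctor.extend_induction with
      | zero => simp only [map_zero, AddMonoidHom.zero_apply]
      | add x z hx hz => simp only [map_add, AddMonoidHom.add_apply, hx, hz]
      | tmul s y =>
        induction c using MackeyFunctor.extend_induction with
        | zero => simp only [map_zero]
        | add x z hx hz => simp only [map_add, hx, hz]
        | tmul t z =>
          exact congrArg₂ (· ⊗ₜ[ℤ] ·) (_root_.mul_assoc r s t) (𝒢.mul_assoc S x y z)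
  one_mul S a := by
    induction a using MackeyFunctor.extend_induction with
    | zero => simp only [map_zero]
    | add x z hx hz => simp only [map_add, hx, hz]
    | tmul r x => exact congrArg₂ (· ⊗ₜ[ℤ] ·) (_root_.one_mul r) (𝒢.one_mul S x)
  mul_one S a := by
    induction a using MackeyFunctor.extend_induction with
    | zero => rw [map_zero]; rfl
    | add x z hx hz => rw [map_add]; exact congrArg₂ (· + ·) hx hz
    | tmul r x => exact congrArg₂ (· ⊗ₜ[ℤ] ·) (_root_.mul_one r) (𝒢.mul_one S x)
  pull_one φ := congrArg ((1 : R) ⊗ₜ[ℤ] ·) (𝒢.pull_one φ)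

instance (𝒢 : GreenRing.{u, v} G) (R : Type) [CommRing R] : (𝒢.extend R).IsLinear R where
  push_smul := 𝒢.functor.extend_push_smul R
  pull_smul := 𝒢.functor.extend_pull_smul R
  smul_mul := 𝒢.pairing.extend_smul_mul R
  mul_smul := 𝒢.pairing.extend_mul_smul R

/-! ### The extended action on a Green module. -/

theorem GreenModule.extend_one_smul {𝒢 : GreenRing.{u, v} G} {M : MackeyFunctor.{u, w} G}
    (act : GreenModule 𝒢 M) (R : Type) [CommRing R] {S : FinGSet G} (x : (M.extend R).obj S) :
    (act.pairing.extend R).mul S ((𝒢.extend R).one S) x = x := by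
  induction x using MackeyFunctor.extend_induction with
  | zero => simp only [map_zero]
  | add x z hx hz => simp only [map_add, hx, hz]
  | tmul r x => exact congrArg₂ (· ⊗ₜ[ℤ] ·) (_root_.one_mul r) (act.one_smul S x)

/-- Frobenius reciprocity for the transfer of the unit; for `S = G/H` this turns Burnside
coefficients into the terms `Ind ∘ Res`. -/
theorem GreenModule.extend_burnside_smul {𝒢 : GreenRing.{u, v} G} {M : MackeyFunctor.{u, w} G}
    (act : GreenModule 𝒢 M) (R : Type) [CommRing R] (S : FinGSet G)
    (x : (M.extend R).obj (FinGSet.point G)) :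
    (act.pairing.extend R).mul _ ((𝒢.extend R).burnside S) x =
      (M.extend R).push S.toPoint ((M.extend R).pull S.toPoint x) := by
  rw [GreenRing.burnside, (act.pairing.extend R).push_mul, act.extend_one_smul]

theorem ZAtPrime.isUnit_natCast {p : ℕ} [Fact p.Prime] {n : ℕ} (hn : ¬ p ∣ n) :
    IsUnit (n : ZAtPrime p) := by
  have h := IsLocalization.map_units (ZAtPrime p)
    (⟨(n : ℤ), fun h => hn (Int.natCast_dvd_natCast.1 (Ideal.mem_span_singleton.1 h))⟩ :
      (Ideal.span {(p : ℤ)}).primeCompl)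
  simpa using h

end

/-! ### The induction formula. -/

theorem theorem3p7 {G : Type u} [Group G] [Finite G] (p : ℕ) [Fact p.Prime]
    (𝒢 : GreenRing.{u, v} G) (M : MackeyFunctor.{u, w} G) (act : GreenModule 𝒢 M)
    (ℱ : SubgroupFamily G) (hℱ : ℱ.HyperClosed p)
    (hcomp : (𝒢.functor.extend (ZAtPrime p)).FamilyComputable ℱ) :
    ∃ a : Subgroup G → ZAtPrime p,
      ∀ x : (M.extend (ZAtPrime p)).obj (FinGSet.point G),
        x = ∑ H ∈ ℱ.members,
          a H • (M.extend (ZAtPrime p)).ind H ((M.extend (ZAtPrime p)).res H x) := by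
  let Γ := 𝒢.extend (ZAtPrime p)
  obtain ⟨s, hs, -⟩ := (hcomp (FinGSet.point G)).1
  -- In degree zero with `Y = •`, the boundary is the transfer along `X(ℱ) × • → •`, and the
  -- homotopy gives a preimage of the unit.
  have hy : Γ.functor.push (ℱ.gset.prod (FinGSet.point G)).toPoint (s 0 (Γ.one _)) = Γ.one _ := by
    have h := hs (Γ.one _)
    rw [MackeyFunctor.amitsurBoundary, Fin.sum_univ_one, Fin.val_zero, pow_zero, one_smul] at h
    exact h
  have hone : Γ.one _ ∈ Γ.isotropySpan (ZAtPrime p) ℱ := by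
    refine Γ.one_mem_isotropySpan (fun K hK => ?_)
      ((FinGSet.isotropyIn_gset ℱ).of_hom (FinGSet.fst _ _)) _ hy
    obtain ⟨P, hP, hdvd⟩ := hℱ.exists_not_dvd_card_fixedBy hK
    exact ⟨P, hP, ZAtPrime.isUnit_natCast hdvd⟩
  have hspan := Γ.isotropySpan_le_span_quot ℱ hone
  rw [← (Set.toFinite ℱ.carrier).coe_toFinset,
    Submodule.mem_span_image_finset_iff_exists_fun'] at hspan
  obtain ⟨a, ha⟩ := hspan
  refine ⟨a, fun x => ?_⟩
  -- Write `x = 1 · x` and expand the unit; the coefficients `a` come from the Green ring and so do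
  -- not depend on `x`.
  conv_lhs => rw [← act.extend_one_smul (ZAtPrime p) x]
  change (act.pairing.extend (ZAtPrime p)).mul _ (Γ.one _) x = _
  rw [← ha, map_sum, AddMonoidHom.finsetSum_apply]
  refine Finset.sum_congr rfl fun H _ => ?_
  rw [MackeyPairing.extend_smul_mul, act.extend_burnside_smul]
  rfl
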